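/- For $n\ge 1$ let $\mathrm{Tam}_n$ be the Tamari lattice: the set of planar binary trees with $n$ inner vertices, ordered by the reflexive transitive closure of the rotations which, at some vertex, replace a subtree $A\,(B\,C)$ by $(A\,B)\,C$ (so the right comb is the minimum). Write $\triangleleft$ for the cover relation. For trees $A,B$ let $A/B$ be the tree obtained by grafting the root of $A$ on the leftmost leaf of $B$. Every tree $S\in\mathrm{Tam}_n$ has a unique maximal decomposition $S=S_0/S_1/\cdots/S_\ell$ into trees with at least one inner vertex; $S$ is indecomposable if $\ell=0$, and $k_S$ denotes the number of inner vertices of $S_\ell$ (the factor that contains the root). An interval is a pair $(S,T)$ with $S\le T$ in some $\mathrm{Tam}_n$, $n \geq 1$; it is indecomposable if $S$ is. The left border of $T$ consists of the edge below the root and the successive left edges up to the leftmost leaf. If $S\le T$, there is a unique edge of the left border of $T$ such that cutting $T$ there leaves exactly $k_S$ inner vertices in the part that contains the root. Let $V$ be the set of edges of the left border of $T$ consisting of this edge and those above it, and $U$ the set of those below it. To $(S,T)$ attach the monomial $$w(S,T)=u^{|U|}\,v^{|V|}\,x^{\#\{S'\,:\,S\triangleleft S'\le T\}}\,y^{\#\{T'\,:\,T\triangleleft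 T'\}}\,\bar y^{\,\#\{S'\,:\,S'\triangleleft S\}},$$ and let $\Phi(u,v)=\sum_{n\ge1}t^n\sum_{S\le T\text{ in }\mathrm{Tam}_n}w(S,T)$, a formal power series in $t$ with coefficients in $\mathbf{Q}[u,v,x,y,\bar y]$. Let $\Theta(u,v)$ be the same sum restricted to indecomposable intervals. For other arguments, $\Phi(a,b)$ denotes the result of substituting $u=a$, $v=b$. Then $$\Phi(u,v)=\Theta(u,v)+\bar y\,\Phi(v,v)\,\Theta(u,v)/v,$$ $$\Theta(u,v)=tv\Big(u+yu\,\frac{\Phi(u,1)-\Phi(1,1)}{u-1}+xyu\,\frac{\Phi(u,u)-\Phi(u,1)}{u-1}+(x-xy)\,\Phi(u,u)\Big).$$ Moreover, let $\Phi_q$ and $\Theta_q$ be the series obtained when each monomial $w(S,T)$ is multiplied by $q^{\lambda(S,T)}$, where $\lambda(S,T)$ is the length (number of steps) of the longest chain from $S$ to $T$. Then $$\Phi_q(u,v)=\Theta_q(u,v)+\bar y\,\Phi_q(v,v)\,\Theta_q(u,v)/v,$$ $$\Theta_q(u,v)=tv\Big(u+yu\,\frac{\Phi_q(qu,1)-\Phi_q(1,1)}{qu-1}+xyu\,\frac{\Phi_q(qu,qu)-\Phi_q(qu,1)}{qu-1}+\frac{x-xy}{q}\,\Phi_q(qu,qu)\Big).$$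 -/

import Mathlib

open scoped PowerSeries

/-! ### Interval statistics of a poset -/

section Poset

variable {P : Type*} [PartialOrder P]

/-- Power of `x` in the monomial of the interval `(S, T)`: the number of covers
`(S, T) ⋖ (S', T)` with `S ⋖ S' ≤ T`. -/
noncomputable def xDeg (S T : P) : ℕ := {S' : P | S ⋖ S' ∧ S' ≤ T}.ncard

/-- Power of `y` in the monomial of the interval `(S, T)`: the number of covers
`(S, T) ⋖ (S, T')` with `T ⋖ T'`. It depends on `T` only. -/
noncomputable def yDeg (T : P) : ℕ := {T' : P | T ⋖ T'}.ncard

/-- Power of `ȳ` in the monomial of the interval `(S, T)`: the number of covers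
`(S', T) ⋖ (S, T)` with `S' ⋖ S`. It depends on `S` only. -/
noncomputable def ybarDeg (S : P) : ℕ := {S' : P | S' ⋖ S}.ncard

/-- The length (number of steps) of the longest strict chain with minimum `S` and maximum `T`.
It is meant for `S ≤ T` in a finite poset, where the set is nonempty and bounded. -/
noncomputable def longestChain (S T : P) : ℕ :=
  sSup {m : ℕ | ∃ c : LTSeries P, c.head = S ∧ c.last = T ∧ c.length = m}

end Poset

/-! ### The Tamari lattices -/

namespace Tamari

/-- Planar binary trees; `nil` is a leaf and `node () l r` is an inner vertex. -/
abbrev BT := BinaryTree Unit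

/-- `Rot S T`: the tree `T` is obtained from `S` by one rotation at some vertex,
`A (B C) → (A B) C` (the right comb is minimal, the left comb is maximal). -/
inductive Rot : BT → BT → Prop
  | root (A B C : BT) :
      Rot (.node () A (.node () B C)) (.node () (.node () A B) C)
  | left {A A' : BT} (B : BT) (h : Rot A A') : Rot (.node () A B) (.node () A' B)
  | right (A : BT) {B B' : BT} (h : Rot B B') : Rot (.node () A B) (.node () A B')

theorem Rot.numNodes_eq {S T : BT} (h : Rot S T) : S.numNodes = T.numNodes := by
  induction h with
  | root A B C => simp; omega
  | left B h ih => simp [ih]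
  | right A h ih => simp [ih]

/-- Sum of the sizes of the left subtrees; it increases under rotation. -/
def potential : BT → ℕ
  | .nil => 0
  | .node _ l r => potential l + potential r + l.numNodes

theorem Rot.potential_lt {S T : BT} (h : Rot S T) : potential S < potential T := by
  induction h with
  | root A B C => simp [potential]; omega
  | left B h ih => simp only [potential, h.numNodes_eq]; omega
  | right A h ih => simp only [potential]; omega

theorem potential_le {S T : BT} (h : Relation.ReflTransGen Rot S T) :
    S = T ∨ potential S < potential T := by
  induction h with
  | refl => exact Or.inl rfl
  | tail _ h ih =>
    rcases ih with rfl | ih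
    · exact Or.inr h.potential_lt
    · exact Or.inr (ih.trans h.potential_lt)

/-- The underlying set of the Tamari lattice: planar binary trees with `n` inner vertices. -/
def Tam (n : ℕ) : Type := {t : BT // t.numNodes = n}

noncomputable instance (n : ℕ) : Fintype (Tam n) :=
  Fintype.subtype (BinaryTree.treesOfNumNodesEq n)
    fun _ => BinaryTree.mem_treesOfNumNodesEq

/-- The Tamari order: the reflexive transitive closure of rotation. -/
instance (n : ℕ) : PartialOrder (Tam n) where
  le S T := Relation.ReflTransGen Rot S.1 T.1
  le_refl _ := Relation.ReflTransGen.refl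
  le_trans _ _ _ h h' := h.trans h'
  le_antisymm S T h h' := by
    rcases potential_le h with e | e
    · exact Subtype.ext e
    · rcases potential_le h' with e' | e'
      · exact Subtype.ext e'.symm
      · omega

/-! ### Decomposition along the left border -/

/-- `graft A B` is `A / B`: the root of `A` is grafted on the leftmost leaf of `B`. -/
def graft (A : BT) : BT → BT
  | .nil => A
  | .node _ l r => .node () (graft A l) r

/-- A tree is indecomposable if it is not a single leaf and is not of the form `A / B` with
both `A` and `B` different from a single leaf. -/
def Indecomposable (S : BT) : Prop :=
  S ≠ .nil ∧ ∀ A B : BT, S = graft A B → A = .nil ∨ B = .nil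

/-- The list `[S₀, …, S_ℓ]` of the maximal decomposition `S = S₀ / S₁ / ⋯ / S_ℓ`. -/
def pieces : BT → List BT
  | .nil => []
  | .node _ l r => pieces l ++ [.node () .nil r]

theorem graft_nil_left (S : BT) : graft .nil S = S := by
  induction S with
  | nil => rfl
  | node _ l r ihl _ => simp [graft, ihl]

theorem foldl_graft_pieces (S : BT) : (pieces S).foldl graft .nil = S := by
  induction S with
  | nil => rfl
  | node _ l r ihl _ => simp [pieces, graft, ihl]

theorem indecomposable_iff (S : BT) : Indecomposable S ↔ ∃ r : BT, S = .node () .nil r := by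
  constructor
  · rintro ⟨h0, h⟩
    cases S with
    | nil => exact absurd rfl h0
    | node a l r =>
      rcases h l (.node () .nil r) rfl with rfl | h1
      · exact ⟨r, rfl⟩
      · cases h1
  · rintro ⟨r, rfl⟩
    refine ⟨by simp, fun A B h => ?_⟩
    cases B with
    | nil => exact Or.inr rfl
    | node b l' r' =>
      simp only [graft, BinaryTree.node.injEq, true_and] at h
      cases l' with
      | nil => exact Or.inl h.1.symm
      | node b' l2 r2 => simp [graft] at h

theorem indecomposable_of_mem_pieces {S p : BT} (h : p ∈ pieces S) : Indecomposable p := by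
  induction S with
  | nil => simp [pieces] at h
  | node _ l r ihl _ =>
    simp only [pieces, List.mem_append, List.mem_singleton] at h
    rcases h with h | rfl
    · exact ihl h
    · exact (indecomposable_iff _).2 ⟨r, rfl⟩

/-- The composition `(n₀, …, n_ℓ)` of sizes of the pieces of `S`. -/
def composition (S : BT) : List ℕ := (pieces S).map BinaryTree.numNodes

/-- `k_S`, the last part of the composition of `S`: the size of the piece holding the root
(and `0` when `S` is a single leaf). -/
def lastPart (S : BT) : ℕ := (composition S).getLastD 0

/-- The left border of `T` consists of the edge below the root and of the successive left
edges, up to the leftmost leaf. From bottom to top, the list gives for every such edge `a`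
the number `k_a(T)` of inner vertices of the part containing the root when `T` is cut at `a`
(it is `0` for the edge below the root). -/
def borderCuts : BT → List ℕ
  | .nil => [0]
  | .node _ l r => 0 :: (borderCuts l).map (fun k => k + r.numNodes + 1)

/-- The number of edges in the upper part `V` of the left border of `T`, with respect to `S`:
the lowest edge of `V` is the one whose cut leaves exactly `k_S` vertices with the root. -/
def vDeg (S T : BT) : ℕ := (borderCuts T).countP (fun k => decide (lastPart S ≤ k))

/-- The number of edges in the lower part `U` of the left border of `T`, with respect to `S`:
the edges below the one whose cut leaves exactly `k_S` vertices with the root. -/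
def uDeg (S T : BT) : ℕ := (borderCuts T).countP (fun k => decide (k < lastPart S))

/-- The numbers `k_a(T)` strictly increase from bottom to top. -/
theorem borderCuts_pairwise (T : BT) : (borderCuts T).Pairwise (· < ·) := by
  induction T with
  | nil => simp [borderCuts]
  | node _ l r ihl _ =>
    simp only [borderCuts, List.pairwise_cons, List.pairwise_map]
    refine ⟨by simp, ihl.imp (by intros; omega)⟩

theorem Rot.borderCuts_subset {S T : BT} (h : Rot S T) : borderCuts S ⊆ borderCuts T := by
  induction h with
  | root A B C =>
    intro k hk
    simp only [borderCuts, List.mem_cons, List.mem_map, BinaryTree.numNodes] at hk ⊢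
    rcases hk with rfl | ⟨a, ha, rfl⟩
    · exact Or.inl rfl
    · exact Or.inr ⟨a + B.numNodes + 1, Or.inr ⟨a, ha, rfl⟩, by omega⟩
  | left B h ih =>
    exact List.cons_subset_cons _ (List.map_subset _ ih)
  | right A h ih => simp [borderCuts, h.numNodes_eq]

/-- For `S ≤ T`, the edge of the left border of `T` used to define `U` and `V` exists. -/
theorem lastPart_mem_borderCuts {n : ℕ} {S T : Tam n} (h : S ≤ T) :
    lastPart S.1 ∈ borderCuts T.1 := by
  have h0 : lastPart S.1 ∈ borderCuts S.1 := by
    obtain ⟨S, hS⟩ := S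
    cases S with
    | nil => simp [lastPart, composition, pieces, borderCuts]
    | node a l r =>
      cases l <;> simp [lastPart, composition, pieces, borderCuts]
  have h1 : ∀ A B : BT, Relation.ReflTransGen Rot A B → borderCuts A ⊆ borderCuts B := by
    intro A B hAB
    induction hAB with
    | refl => exact List.Subset.refl _
    | tail _ h ih => exact List.Subset.trans ih h.borderCuts_subset
  exact h1 _ _ h h0

/-! ### The generating series -/

/-- The names of the indeterminates. -/
inductive Var
  | u | v | x | y | ybar | q

/-- The polynomial ring `ℚ[u, v, x, y, ȳ, q]`. -/
abbrev Coeff := MvPolynomial Var ℚ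

/-- The field of fractions `ℚ(u, v, x, y, ȳ, q)`. -/
abbrev K := FractionRing Coeff

/-- The indeterminates, as elements of the field of fractions. -/
noncomputable def var (i : Var) : K := algebraMap Coeff K (MvPolynomial.X i)

/-- The monomial in `u, v, x, y, ȳ` of an interval `(S, T)`. -/
noncomputable def weight {n : ℕ} (S T : Tam n) : Coeff :=
  MvPolynomial.X .u ^ uDeg S.1 T.1 * MvPolynomial.X .v ^ vDeg S.1 T.1 *
    MvPolynomial.X .x ^ xDeg S T * MvPolynomial.X .y ^ yDeg T * MvPolynomial.X .ybar ^ ybarDeg S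

/-- The monomial with the extra variable `q` for the length of the longest chain. -/
noncomputable def weightQ {n : ℕ} (S T : Tam n) : Coeff :=
  weight S T * MvPolynomial.X .q ^ longestChain S T

open Classical in
/-- `∑_{n ≥ 1} tⁿ ∑ w(S, T)`, the inner sum being over the intervals `S ≤ T` of the `n`-th
Tamari lattice. -/
noncomputable def allSeries (w : ∀ {n : ℕ}, Tam n → Tam n → Coeff) : Coeff⟦X⟧ :=
  PowerSeries.mk fun n =>
    if n = 0 then 0 else ∑ I : Tam n × Tam n with I.1 ≤ I.2, w I.1 I.2

open Classical in
/-- The same sum, over the indecomposable intervals, those with `S` indecomposable. -/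
noncomputable def indecSeries (w : ∀ {n : ℕ}, Tam n → Tam n → Coeff) : Coeff⟦X⟧ :=
  PowerSeries.mk fun n =>
    if n = 0 then 0
    else ∑ I : Tam n × Tam n with I.1 ≤ I.2 ∧ Indecomposable I.1.1, w I.1 I.2

/-- The substitution `u ↦ a`, `v ↦ b` in the coefficients, the other variables being fixed. -/
noncomputable def substUV (a b : K) : Coeff →ₐ[ℚ] K :=
  MvPolynomial.aeval fun i : Var =>
    match i with
    | .u => a
    | .v => b
    | i => var i

/-- `Φ(a, b)`, the series of all intervals with `u = a` and `v = b`. -/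
noncomputable def Phi (a b : K) : K⟦X⟧ :=
  PowerSeries.map (substUV a b : Coeff →+* K) (allSeries weight)

/-- `Θ(a, b)`, the series of indecomposable intervals with `u = a` and `v = b`. -/
noncomputable def Theta (a b : K) : K⟦X⟧ :=
  PowerSeries.map (substUV a b : Coeff →+* K) (indecSeries weight)

/-- `Φ(a, b)` refined by the variable `q`. -/
noncomputable def PhiQ (a b : K) : K⟦X⟧ :=
  PowerSeries.map (substUV a b : Coeff →+* K) (allSeries weightQ)

/-- `Θ(a, b)` refined by the variable `q`. -/
noncomputable def ThetaQ (a b : K) : K⟦X⟧ :=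
  PowerSeries.map (substUV a b : Coeff →+* K) (indecSeries weightQ)

end Tamari

/-!
Both pairs of equations come from two bijections on intervals of binary trees, and `c = 1` or
`c = q` in `intervalMonomial` treats the two versions at once.

A rotation of a grafting `A / B` takes place in `A` or in `B`, so the chains from `A / B` are
shuffles of chains from `A` and from `B` (`RotChain.of_graft`). If `B` is the indecomposable factor
of `S = A / B` that holds the root, the intervals `(S, T)` are the pairs of an interval `(A, A')`
and an indecomposable interval `(B, B')`, and the monomials multiply up to the factor `ȳ / v`
(`intervalMonomial_graft`). This is the equation for `Φ`.

An indecomposable tree has the form `S = node nil R`. The trees above it arise from the trees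
`T ≥ R` by inserting a new first vertex on some edge `p` of the left border of `T`
(`RotChain.of_node_nil`, `le_ins_iff`): every rotation of such a tree `ins p T` increases `T` or
`p`, and neither ever decreases. Hence the longest chain grows by `p` (`maxChain_ins`). Insertion
on any edge but the top one creates a place for a rotation (`rotCount_ins`), and the rotation at
the root of `S` stays below `ins p T` exactly if `p` is in the upper part of the border
(`upCount_ins`). Summing over `p` gives two geometric sums and a term for the top edge
(`sum_intervalMonomial_ins`), which is the equation for `Θ`.

The two descriptions of chains also show that comparable rotations of the same tree are equal
(`Rot.eq_of_le`), so that rotations are the covers of the Tamari lattice (`covBy_iff_rot`) and the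
statistics can be computed on trees.
-/

namespace Tamari

/-! ### Chains of rotations -/

/-- `RotChain m S T`: the tree `T` is reached from `S` by exactly `m` rotations. -/
inductive RotChain : ℕ → BT → BT → Prop
  | refl (S : BT) : RotChain 0 S S
  | tail {m : ℕ} {S T T' : BT} (h : RotChain m S T) (h' : Rot T T') : RotChain (m + 1) S T'

/-- The Tamari order, on trees of unspecified size. -/
abbrev Le (S T : BT) : Prop := Relation.ReflTransGen Rot S T

theorem RotChain.le {m : ℕ} {S T : BT} (h : RotChain m S T) : Le S T := by
  induction h with
  | refl S => exact .refl
  | tail _ h' ih => exact ih.tail h'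

theorem Le.exists_rotChain {S T : BT} (h : Le S T) : ∃ m, RotChain m S T := by
  induction h with
  | refl => exact ⟨0, .refl _⟩
  | tail _ h' ih => exact ih.imp' (· + 1) fun _ h => h.tail h'

theorem RotChain.trans {m k : ℕ} {S T Z : BT} (h : RotChain m S T) (h' : RotChain k T Z) :
    RotChain (m + k) S Z := by
  induction h' with
  | refl => exact h
  | tail _ r ih => exact (ih h).tail r

theorem RotChain.map {f : BT → BT} (hf : ∀ {A B : BT}, Rot A B → Rot (f A) (f B)) {m : ℕ}
    {S T : BT} (h : RotChain m S T) : RotChain m (f S) (f T) := by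
  induction h with
  | refl S => exact .refl _
  | tail _ h' ih => exact ih.tail (hf h')

theorem RotChain.potential_add_le {m : ℕ} {S T : BT} (h : RotChain m S T) :
    potential S + m ≤ potential T := by
  induction h with
  | refl S => simp
  | tail _ h' ih => have := h'.potential_lt; omega

theorem Le.numNodes_eq {S T : BT} (h : Le S T) : S.numNodes = T.numNodes := by
  induction h with
  | refl => rfl
  | tail _ h' ih => exact ih.trans h'.numNodes_eq

theorem Rot.ne {S T : BT} (h : Rot S T) : S ≠ T := by
  rintro rfl; exact lt_irrefl _ h.potential_lt

theorem Rot.not_le {S T : BT} (h : Rot S T) : ¬ Le T S := by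
  intro h'
  have := h.potential_lt
  rcases potential_le h' with rfl | h' <;> omega

/-- The number of rotations in the longest chain of rotations from `S` to `T`. -/
noncomputable def maxChain (S T : BT) : ℕ := sSup {m | RotChain m S T}

theorem bddAbove_rotChain (S T : BT) : BddAbove {m | RotChain m S T} :=
  ⟨potential T, fun _ h => (Nat.le_add_left _ _).trans (RotChain.potential_add_le h)⟩

theorem RotChain.le_maxChain {m : ℕ} {S T : BT} (h : RotChain m S T) : m ≤ maxChain S T :=
  le_csSup (bddAbove_rotChain S T) h

theorem Le.rotChain_maxChain {S T : BT} (h : Le S T) : RotChain (maxChain S T) S T :=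
  Nat.sSup_mem h.exists_rotChain (bddAbove_rotChain S T)

/-! ### Grafting and the order -/

theorem numNodes_graft (A B : BT) : (graft A B).numNodes = A.numNodes + B.numNodes := by
  induction B with
  | nil => simp [graft]
  | node _ l r ihl _ => simp [graft, ihl]; omega

theorem node_eq_graft (L r : BT) : .node () L r = graft L (.node () .nil r) := rfl

theorem Rot.graft_left {A A' : BT} (h : Rot A A') (B : BT) : Rot (graft A B) (graft A' B) := by
  induction B with
  | nil => exact h
  | node _ l r ihl _ => exact ihl.left r

theorem Rot.graft_right (A : BT) {B B' : BT} (h : Rot B B') : Rot (graft A B) (graft A B') := by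
  induction h with
  | root => exact .root _ _ _
  | left B _ ih => exact ih.left B
  | right _ h _ => exact h.right _

theorem Rot.of_graft {A B T : BT} (h : Rot (graft A B) T) :
    (∃ A', Rot A A' ∧ T = graft A' B) ∨ ∃ B', Rot B B' ∧ T = graft A B' := by
  induction B generalizing T with
  | nil => exact .inl ⟨T, h, rfl⟩
  | node a l r ihl _ =>
    change Rot (.node () (graft A l) r) T at h
    cases h with
    | root _ B C => exact .inr ⟨_, .root l B C, rfl⟩
    | left _ h =>
      rcases ihl h with ⟨A', hA, rfl⟩ | ⟨B', hB, rfl⟩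
      · exact .inl ⟨A', hA, rfl⟩
      · exact .inr ⟨_, hB.left r, rfl⟩
    | right _ h => exact .inr ⟨_, h.right l, rfl⟩

theorem RotChain.graft {a b : ℕ} {A A' B B' : BT} (h : RotChain a A A') (h' : RotChain b B B') :
    RotChain (a + b) (graft A B) (graft A' B') :=
  (h.map (f := fun A => Tamari.graft A B) fun r => r.graft_left B).trans
    (h'.map (f := Tamari.graft A') fun r => r.graft_right A')

/-- A rotation never joins the two factors of a grafting, so a chain that starts at `A / B`
splits into a chain from `A` and a chain from `B`. -/
theorem RotChain.of_graft {m : ℕ} {A B T : BT} (h : RotChain m (Tamari.graft A B) T) :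
    ∃ A' B' a b, T = Tamari.graft A' B' ∧ RotChain a A A' ∧ RotChain b B B' ∧ m = a + b := by
  generalize hS : Tamari.graft A B = S at h
  induction h with
  | refl => exact ⟨A, B, 0, 0, hS.symm, .refl _, .refl _, rfl⟩
  | tail _ r ih =>
    obtain ⟨A', B', a, b, rfl, ha, hb, rfl⟩ := ih hS
    rcases r.of_graft with ⟨A'', hA, rfl⟩ | ⟨B'', hB, rfl⟩
    · exact ⟨A'', B', a + 1, b, rfl, ha.tail hA, hb, by omega⟩
    · exact ⟨A', B'', a, b + 1, rfl, ha, hb.tail hB, by omega⟩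

/-- The size of `A` determines where `A / B` is to be cut. -/
theorem graft_inj {A B A' B' : BT} (hA : A.numNodes = A'.numNodes)
    (h : graft A B = graft A' B') : A = A' ∧ B = B' := by
  induction B generalizing B' with
  | nil =>
    cases B' with
    | nil => exact ⟨h, rfl⟩
    | node _ l r =>
      have := congrArg BinaryTree.numNodes h
      simp only [numNodes_graft, BinaryTree.numNodes] at this
      omega
  | node _ l r ihl _ =>
    cases B' with
    | nil =>
      have := congrArg BinaryTree.numNodes h
      simp only [numNodes_graft, BinaryTree.numNodes] at this
      omega
    | node _ l' r' =>
      simp only [graft, BinaryTree.node.injEq, true_and] at h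
      obtain ⟨rfl, rfl⟩ := ihl h.1
      exact ⟨rfl, by rw [h.2]⟩

theorem Le.graft {A A' B B' : BT} (h : Le A A') (h' : Le B B') :
    Le (graft A B) (graft A' B') := by
  obtain ⟨a, ha⟩ := h.exists_rotChain
  obtain ⟨b, hb⟩ := h'.exists_rotChain
  exact (ha.graft hb).le

theorem Le.of_graft {A B T : BT} (h : Le (Tamari.graft A B) T) :
    ∃ A' B', T = Tamari.graft A' B' ∧ Le A A' ∧ Le B B' := by
  obtain ⟨m, h⟩ := h.exists_rotChain
  obtain ⟨A', B', a, b, rfl, ha, hb, -⟩ := h.of_graft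
  exact ⟨A', B', rfl, ha.le, hb.le⟩

theorem le_graft_iff {A A' B B' : BT} (hA : A.numNodes = A'.numNodes) :
    Le (graft A B) (graft A' B') ↔ Le A A' ∧ Le B B' := by
  refine ⟨fun h => ?_, fun h => h.1.graft h.2⟩
  obtain ⟨A'', B'', e, ha, hb⟩ := h.of_graft
  obtain ⟨rfl, rfl⟩ := graft_inj (hA.symm.trans ha.numNodes_eq) e
  exact ⟨ha, hb⟩

theorem maxChain_graft {A A' B B' : BT} (hA : Le A A') (hB : Le B B') :
    maxChain (graft A B) (graft A' B') = maxChain A A' + maxChain B B' := by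
  apply le_antisymm
  · obtain ⟨A'', B'', a, b, e, ha, hb, h⟩ := (hA.graft hB).rotChain_maxChain.of_graft
    obtain ⟨rfl, rfl⟩ := graft_inj (hA.numNodes_eq.symm.trans ha.le.numNodes_eq) e
    rw [h]
    exact add_le_add ha.le_maxChain hb.le_maxChain
  · exact (hA.rotChain_maxChain.graft hB.rotChain_maxChain).le_maxChain

/-! ### Inserting a first vertex -/

/-- The number of inner vertices on the left border; the left border has `spine T + 1` edges. -/
def spine : BT → ℕ
  | .nil => 0
  | .node _ l _ => spine l + 1

/-- `ins p T` inserts a new vertex in the middle of the edge number `p` of the left border of `T`,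
counted from the bottom: what was above that edge becomes the right subtree of the new vertex,
and the left subtree of the new vertex is a leaf. Meaningful for `p ≤ spine T` only. -/
def ins : ℕ → BT → BT
  | 0, T => .node () .nil T
  | _ + 1, .nil => .nil
  | p + 1, .node _ l r => .node () (ins p l) r

/-- Deletes the last vertex of the left border, which is replaced by its right subtree. -/
def deleteFirst : BT → BT
  | .nil => .nil
  | .node _ .nil r => r
  | .node _ (.node a l l') r => .node () (deleteFirst (.node a l l')) r

theorem spine_graft (A B : BT) : spine (graft A B) = spine A + spine B := by
  induction B with
  | nil => rfl
  | node _ l r ihl _ => simp only [graft, spine, ihl, add_assoc]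

theorem spine_ins {p : ℕ} {T : BT} (h : p ≤ spine T) : spine (ins p T) = p + 1 := by
  induction p generalizing T with
  | zero => rfl
  | succ p ih =>
    cases T with
    | nil => simp [spine] at h
    | node _ l r => simp only [ins, spine, ih (Nat.le_of_succ_le_succ h)]

theorem deleteFirst_ins {p : ℕ} {T : BT} (h : p ≤ spine T) : deleteFirst (ins p T) = T := by
  induction p generalizing T with
  | zero => rfl
  | succ p ih =>
    cases T with
    | nil => simp [spine] at h
    | node _ l r =>
      have h' := Nat.le_of_succ_le_succ h
      have := ih h'
      cases hi : ins p l with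
      | nil => have := spine_ins h'; simp [hi, spine] at this
      | node _ l' r' => rw [hi] at this; simp only [ins, hi, deleteFirst, this]

theorem ins_inj {p p' : ℕ} {T T' : BT} (h : p ≤ spine T) (h' : p' ≤ spine T')
    (e : ins p T = ins p' T') : p = p' ∧ T = T' := by
  have h1 := congrArg spine e
  have h2 := congrArg deleteFirst e
  rw [spine_ins h, spine_ins h'] at h1
  rw [deleteFirst_ins h, deleteFirst_ins h'] at h2
  exact ⟨Nat.succ_injective h1, h2⟩

theorem ins_graft (p : ℕ) (A B : BT) : ins (p + spine B) (graft A B) = graft (ins p A) B := by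
  induction B with
  | nil => rfl
  | node _ l r ihl _ => simp only [graft, spine, ← ihl, ← add_assoc, ins]

theorem rot_ins_succ {p : ℕ} {T : BT} (h : p < spine T) : Rot (ins p T) (ins (p + 1) T) := by
  induction p generalizing T with
  | zero =>
    cases T with
    | nil => simp [spine] at h
    | node _ l r => exact .root _ _ _
  | succ p ih =>
    cases T with
    | nil => simp [spine] at h
    | node _ l r => exact (ih (Nat.lt_of_succ_lt_succ h)).left r

theorem rotChain_ins {p : ℕ} {T : BT} (h : p ≤ spine T) :
    RotChain p (.node () .nil T) (ins p T) := by
  induction p with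
  | zero => exact .refl _
  | succ p ih => exact (ih (Nat.le_of_succ_le h)).tail (rot_ins_succ h)

/-- A rotation of `ins p T` rotates at the inserted vertex, and then moves it one edge upwards, or
comes from a rotation of `T`, and then the inserted vertex stays at its place or is pushed one
edge upwards. -/
theorem Rot.of_ins {p : ℕ} {T Z : BT} (hp : p ≤ spine T) (h : Rot (ins p T) Z) :
    (p + 1 ≤ spine T ∧ Z = ins (p + 1) T) ∨
      ∃ T' p', Rot T T' ∧ p ≤ p' ∧ p' ≤ spine T' ∧ Z = ins p' T' := by
  induction p generalizing T Z with
  | zero =>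
    change Rot (.node () .nil T) Z at h
    cases h with
    | root _ B C => exact .inl ⟨by simp [spine], rfl⟩
    | left _ h => cases h
    | right _ h => exact .inr ⟨_, 0, h, le_rfl, Nat.zero_le _, rfl⟩
  | succ p ih =>
    cases T with
    | nil => simp [spine] at hp
    | node _ l r =>
      have hp' := Nat.le_of_succ_le_succ hp
      change Rot (.node () (ins p l) r) Z at h
      cases h with
      | root _ B C =>
        exact .inr ⟨_, p + 2, .root l B C, by omega, by simp only [spine]; omega, rfl⟩
      | left _ h =>
        rcases ih hp' h with ⟨hlt, rfl⟩ | ⟨T', p', hT, h1, h2, rfl⟩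
        · exact .inl ⟨Nat.succ_le_succ hlt, rfl⟩
        · exact .inr ⟨_, p' + 1, hT.left r, by omega, Nat.succ_le_succ h2, rfl⟩
      | right _ h => exact .inr ⟨_, p + 1, h.right l, le_rfl, hp, rfl⟩

/-- The trees above `node R` with empty left subtree are the insertions into the trees above `R`.
Along a chain, each step increases the tree `T` or the position of the inserted vertex. -/
theorem RotChain.of_node_nil {m : ℕ} {R Z : BT} (h : RotChain m (.node () .nil R) Z) :
    ∃ T p a, Z = ins p T ∧ p ≤ spine T ∧ RotChain a R T ∧ m ≤ a + p := by
  generalize hS : BinaryTree.node () .nil R = S at h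
  induction h with
  | refl => exact ⟨R, 0, 0, hS.symm, Nat.zero_le _, .refl _, le_rfl⟩
  | tail _ r ih =>
    obtain ⟨T, p, a, rfl, hp, ha, hm⟩ := ih hS
    rcases r.of_ins hp with ⟨h, rfl⟩ | ⟨T', p', h, h1, h2, rfl⟩
    · exact ⟨T, p + 1, a, rfl, h, ha, by omega⟩
    · exact ⟨T', p', a + 1, rfl, h2, ha.tail h, by omega⟩

theorem Le.of_node_nil {R Z : BT} (h : Le (.node () .nil R) Z) :
    ∃ T p, Z = ins p T ∧ p ≤ spine T ∧ Le R T := by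
  obtain ⟨m, h⟩ := h.exists_rotChain
  obtain ⟨T, p, a, e, hp, ha, -⟩ := h.of_node_nil
  exact ⟨T, p, e, hp, ha.le⟩

theorem RotChain.ins {p a : ℕ} {R T : BT} (hp : p ≤ spine T) (h : RotChain a R T) :
    RotChain (a + p) (.node () .nil R) (ins p T) :=
  (h.map (f := .node () .nil) fun r => r.right .nil).trans (rotChain_ins hp)

theorem le_ins_iff {p : ℕ} {R T : BT} (hp : p ≤ spine T) :
    Le (.node () .nil R) (ins p T) ↔ Le R T := by
  constructor
  · intro h
    obtain ⟨T', p', e, hp', h⟩ := h.of_node_nil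
    obtain ⟨rfl, rfl⟩ := ins_inj hp hp' e
    exact h
  · intro h
    obtain ⟨a, h⟩ := h.exists_rotChain
    exact (h.ins hp).le

/-- The bound `m ≤ a + p` for all chains is attained by the chain that first rises from `R` to `T`
in the right subtree and then moves the inserted vertex up one edge at a time. -/
theorem maxChain_ins {p : ℕ} {R T : BT} (hp : p ≤ spine T) (h : Le R T) :
    maxChain (.node () .nil R) (ins p T) = maxChain R T + p := by
  apply le_antisymm
  · obtain ⟨T', p', a, e, hp', ha, hm⟩ := ((le_ins_iff hp).2 h).rotChain_maxChain.of_node_nil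
    obtain ⟨rfl, rfl⟩ := ins_inj hp hp' e
    exact hm.trans (Nat.add_le_add_right ha.le_maxChain _)
  · exact (h.rotChain_maxChain.ins hp).le_maxChain

/-! ### Rotations are the covers of the Tamari lattice -/

theorem Rot.of_node_nil {R Z : BT} (h : Rot (.node () .nil R) Z) :
    (∃ R', Rot R R' ∧ Z = .node () .nil R') ∨
      ∃ L r, R = .node () L r ∧ Z = .node () (.node () .nil L) r := by
  cases h with
  | root _ B C => exact .inr ⟨B, C, rfl, rfl⟩
  | left _ h => cases h
  | right _ h => exact .inl ⟨_, h, rfl⟩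

theorem spine_mono {S T : BT} (h : Le S T) : spine S ≤ spine T := by
  have key : ∀ {S T : BT}, Rot S T → spine S ≤ spine T := by
    intro S T h
    induction h with
    | root => simp [spine]
    | left _ _ ih => simpa [spine] using ih
    | right => exact le_rfl
  induction h with
  | refl => exact le_rfl
  | tail _ h ih => exact ih.trans (key h)

/-- Two rotations of the same tree are comparable only if they are equal. -/
theorem Rot.eq_of_le {S T Z : BT} (h : Rot S T) (hZ : Rot S Z) (hle : Le Z T) : Z = T := by
  induction h generalizing Z with
  | root A C D =>
    rcases Rot.of_graft (A := A) (B := (.node () .nil (.node () C D))) hZ with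
      ⟨A', hA, rfl⟩ | ⟨B', hB, rfl⟩
    · have := (le_graft_iff (B' := .node () (.node () .nil C) D) hA.numNodes_eq.symm).1 hle
      exact absurd this.1 hA.not_le
    · have := ((le_graft_iff (B' := .node () (.node () .nil C) D) rfl).1 hle).2
      rcases hB.of_node_nil with ⟨R', hR, rfl⟩ | ⟨L, r, e, rfl⟩
      · exact absurd ((le_ins_iff (p := 1) (T := .node () C D) (by simp [spine])).1 this) hR.not_le
      · cases e; rfl
  | @left A A' B hA ih =>
    rcases Rot.of_graft (A := A) (B := (.node () .nil B)) hZ with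
      ⟨A₁, hA₁, rfl⟩ | ⟨B₁, hB₁, rfl⟩
    · have := (le_graft_iff (B' := .node () .nil B)
        (hA₁.numNodes_eq.symm.trans hA.numNodes_eq)).1 hle
      rw [ih hA₁ this.1]; rfl
    · have := (le_graft_iff (B' := .node () .nil B) hA.numNodes_eq).1 hle
      exact absurd this.2 hB₁.not_le
  | @right A B B' hB ih =>
    rcases Rot.of_graft (A := A) (B := (.node () .nil B)) hZ with
      ⟨A₁, hA₁, rfl⟩ | ⟨B₁, hB₁, rfl⟩
    · have := (le_graft_iff (B' := .node () .nil B') hA₁.numNodes_eq.symm).1 hle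
      exact absurd this.1 hA₁.not_le
    · have := ((le_graft_iff (B' := .node () .nil B') rfl).1 hle).2
      rcases hB₁.of_node_nil with ⟨R', hR, rfl⟩ | ⟨L, r, e, rfl⟩
      · rw [ih hR ((le_ins_iff (p := 0) (Nat.zero_le _)).1 this)]; rfl
      · have := spine_mono this
        simp [spine] at this

theorem covBy_iff_rot {n : ℕ} {S T : Tam n} : S ⋖ T ↔ Rot S.1 T.1 := by
  constructor
  · intro h
    rcases Relation.ReflTransGen.cases_head (show Le S.1 T.1 from h.le) with e | ⟨Z, hZ, hle⟩
    · exact absurd (Subtype.ext e) h.lt.ne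
    · let Z' : Tam n := ⟨Z, hZ.numNodes_eq.symm.trans S.2⟩
      have hSZ : S < Z' := lt_of_le_of_ne (Relation.ReflTransGen.single hZ)
        fun e => hZ.ne (congrArg Subtype.val e)
      have : Z' = T := by
        by_contra hne
        exact h.2 hSZ (lt_of_le_of_ne hle hne)
      rw [← this]; exact hZ
  · intro h
    refine ⟨lt_of_le_of_ne (Relation.ReflTransGen.single h)
      fun e => h.ne (congrArg Subtype.val e), fun Z hSZ hZT => ?_⟩
    rcases Relation.ReflTransGen.cases_head (show Le S.1 Z.1 from hSZ.le) with e | ⟨Y, hY, hle⟩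
    · exact hSZ.ne (Subtype.ext e)
    · obtain rfl := h.eq_of_le hY (hle.trans hZT.le)
      exact hZT.not_ge hle

/-! ### Counting rotations -/

theorem finite_numNodes_eq (n : ℕ) : {T : BT | T.numNodes = n}.Finite :=
  (BinaryTree.treesOfNumNodesEq n).finite_toSet.subset
    fun _ h => Finset.mem_coe.2 (BinaryTree.mem_treesOfNumNodesEq.2 h)

theorem finite_rot_and (S : BT) (p : BT → Prop) : {T | Rot S T ∧ p T}.Finite :=
  (finite_numNodes_eq S.numNodes).subset fun _ h => h.1.numNodes_eq.symm

theorem finite_rot_to (T : BT) : {S | Rot S T}.Finite :=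
  (finite_numNodes_eq T.numNodes).subset fun _ h => Rot.numNodes_eq h

/-- The number of rotations of `S` that stay below `T`. -/
noncomputable def upCount (S T : BT) : ℕ := {S' | Rot S S' ∧ Le S' T}.ncard

/-- The number of rotations of `T`. -/
noncomputable def rotCount (T : BT) : ℕ := {T' | Rot T T'}.ncard

/-- The number of trees of which `S` is a rotation. -/
noncomputable def downCount (S : BT) : ℕ := {S' | Rot S' S}.ncard

theorem ncard_rot_graft (A B : BT) (p : BT → Prop) :
    {Z | Rot (graft A B) Z ∧ p Z}.ncard =
      {A' | Rot A A' ∧ p (graft A' B)}.ncard + {B' | Rot B B' ∧ p (graft A B')}.ncard := by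
  have e : {Z | Rot (graft A B) Z ∧ p Z} =
      (graft · B) '' {A' | Rot A A' ∧ p (graft A' B)} ∪
        graft A '' {B' | Rot B B' ∧ p (graft A B')} := by
    ext Z
    constructor
    · rintro ⟨h, hp⟩
      rcases h.of_graft with ⟨A', hA, rfl⟩ | ⟨B', hB, rfl⟩
      · exact .inl ⟨A', ⟨hA, hp⟩, rfl⟩
      · exact .inr ⟨B', ⟨hB, hp⟩, rfl⟩
    · rintro (⟨A', ⟨hA, hp⟩, rfl⟩ | ⟨B', ⟨hB, hp⟩, rfl⟩)
      · exact ⟨hA.graft_left B, hp⟩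
      · exact ⟨hB.graft_right A, hp⟩
  rw [e, Set.ncard_union_eq ?_ ((finite_rot_and _ _).image _) ((finite_rot_and _ _).image _),
    Set.InjOn.ncard_image, Set.InjOn.ncard_image]
  · exact fun B₁ _ B₂ _ h => (graft_inj rfl h).2
  · exact fun A₁ h₁ A₂ h₂ h => (graft_inj (h₁.1.numNodes_eq.symm.trans h₂.1.numNodes_eq) h).1
  · rw [Set.disjoint_left]
    rintro _ ⟨A', ⟨hA, -⟩, rfl⟩ ⟨B', -, h⟩
    exact hA.ne (graft_inj hA.numNodes_eq h).1

theorem ncard_rot_node_nil (R : BT) (p : BT → Prop) :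
    {Z | Rot (.node () .nil R) Z ∧ p Z}.ncard =
      {R' | Rot R R' ∧ p (.node () .nil R')}.ncard +
        {Z | (∃ L r, R = .node () L r ∧ Z = .node () (.node () .nil L) r) ∧ p Z}.ncard := by
  have e : {Z | Rot (.node () .nil R) Z ∧ p Z} =
      (.node () .nil ·) '' {R' | Rot R R' ∧ p (.node () .nil R')} ∪
        {Z | (∃ L r, R = .node () L r ∧ Z = .node () (.node () .nil L) r) ∧ p Z} := by
    ext Z
    constructor
    · rintro ⟨h, hp⟩
      rcases h.of_node_nil with ⟨R', hR, rfl⟩ | h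
      · exact .inl ⟨R', ⟨hR, hp⟩, rfl⟩
      · exact .inr ⟨h, hp⟩
    · rintro (⟨R', ⟨hR, hp⟩, rfl⟩ | ⟨⟨L, r, rfl, rfl⟩, hp⟩)
      · exact ⟨hR.right _, hp⟩
      · exact ⟨.root _ _ _, hp⟩
  rw [e, Set.ncard_union_eq ?_ ((finite_rot_and _ _).image _)
    ((finite_rot_and (.node () .nil R) p).subset (by rw [e]; exact Set.subset_union_right)),
    Set.InjOn.ncard_image]
  · exact fun _ _ _ _ h => by simpa using h
  · rw [Set.disjoint_left]
    rintro _ ⟨R', -, rfl⟩ ⟨⟨L, r, -, h⟩, -⟩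
    simp at h

theorem upCount_graft {A A' B B' : BT} (hA : Le A A') (hB : Le B B') :
    upCount (graft A B) (graft A' B') = upCount A A' + upCount B B' := by
  rw [upCount, ncard_rot_graft, upCount, upCount]
  congr 3
  · ext Z
    exact and_congr_right fun h => (le_graft_iff (h.numNodes_eq.symm.trans hA.numNodes_eq)).trans
      (and_iff_left hB)
  · ext Z
    exact and_congr_right fun _ => (le_graft_iff hA.numNodes_eq).trans (and_iff_right hA)

theorem rotCount_graft (A B : BT) : rotCount (graft A B) = rotCount A + rotCount B := by
  simpa [rotCount] using ncard_rot_graft A B fun _ => True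

theorem rotCount_nil : rotCount .nil = 0 := by
  have : {T' | Rot .nil T'} = ∅ := by ext; constructor <;> rintro ⟨⟩
  rw [rotCount, this, Set.ncard_empty]

theorem rotCount_node_nil {R : BT} (hR : R ≠ .nil) :
    rotCount (.node () .nil R) = rotCount R + 1 := by
  cases R with
  | nil => exact absurd rfl hR
  | node _ L r =>
    have := ncard_rot_node_nil (.node () L r) fun _ => True
    simp only [and_true] at this
    rw [rotCount, this, rotCount]
    congr 1
    rw [Set.ncard_eq_one]
    exact ⟨.node () (.node () .nil L) r, by ext; simp⟩

/-- Insertion in the top edge of the left border creates a vertex without inner right child, which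
is not the place of a new rotation; insertion in any other edge does. -/
theorem rotCount_ins {p : ℕ} {T : BT} (hp : p ≤ spine T) :
    rotCount (ins p T) = rotCount T + if p < spine T then 1 else 0 := by
  induction p generalizing T with
  | zero =>
    cases T with
    | nil =>
      have := ncard_rot_node_nil .nil fun _ => True
      simp only [and_true] at this
      rw [ins, rotCount, this]
      simp [rotCount, spine]
    | node _ l r => simpa [spine, ins] using rotCount_node_nil (R := .node () l r) (by simp)
  | succ p ih =>
    cases T with
    | nil => simp [spine] at hp
    | node _ l r =>
      have := ih (Nat.le_of_succ_le_succ hp)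
      simp only [ins, spine, Nat.add_lt_add_iff_right]
      rw [node_eq_graft, rotCount_graft, this, node_eq_graft l, rotCount_graft]
      omega

theorem downCount_node_nil (r : BT) : downCount (.node () .nil r) = downCount r := by
  have e : {S | Rot S (.node () .nil r)} = (.node () .nil ·) '' {S | Rot S r} := by
    ext Z
    constructor
    · intro h
      cases (h : Rot Z _) with
      | left _ h => cases h
      | right _ h => exact ⟨_, h, rfl⟩
    · rintro ⟨Z, h, rfl⟩
      exact Rot.right _ h
  rw [downCount, e, Set.ncard_image_of_injective _ fun _ _ h => by simpa using h, downCount]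

/-- A lower cover of `S` is a rotation undone at an inner left edge. The grafting adds one such
edge, between the two factors. -/
theorem downCount_graft {L r : BT} (hL : L ≠ .nil) :
    downCount (graft L (.node () .nil r)) = downCount L + downCount (.node () .nil r) + 1 := by
  rw [downCount_node_nil, ← node_eq_graft]
  cases L with
  | nil => exact absurd rfl hL
  | node _ A B =>
    obtain ⟨L, hL⟩ : ∃ L : BT, L = .node () A B := ⟨_, rfl⟩
    rw [← hL]
    have e : {S | Rot S (.node () L r)} = insert (.node () A (.node () B r))
        ((.node () · r) '' {S | Rot S L} ∪ (.node () L ·) '' {S | Rot S r}) := by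
      ext Z
      constructor
      · intro h
        generalize hT : BinaryTree.node () L r = T at h
        cases (h : Rot Z T) with
        | root A' B' C =>
          rw [hL] at hT
          cases hT
          exact .inl rfl
        | left _ h => cases hT; exact .inr (.inl ⟨_, h, rfl⟩)
        | right _ h => cases hT; exact .inr (.inr ⟨_, h, rfl⟩)
      · rintro (rfl | ⟨Z, h, rfl⟩ | ⟨Z, h, rfl⟩)
        · rw [hL]; exact .root _ _ _
        · exact Rot.left _ h
        · exact Rot.right _ h
    rw [downCount, e, Set.ncard_insert_of_notMem ?_
      (((finite_rot_to _).image _).union ((finite_rot_to _).image _)),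
      Set.ncard_union_eq ?_ ((finite_rot_to _).image _) ((finite_rot_to _).image _),
      Set.ncard_image_of_injective _ fun _ _ h => by simpa using h,
      Set.ncard_image_of_injective _ fun _ _ h => by simpa using h, downCount, downCount]
    · rw [Set.disjoint_left]
      rintro _ ⟨Z, h, rfl⟩ ⟨Y, -, h'⟩
      simp only [BinaryTree.node.injEq, true_and] at h'
      exact Rot.ne h h'.1.symm
    · have hA : A.numNodes ≠ L.numNodes := by simp only [hL, BinaryTree.numNodes]; omega
      rintro (⟨Z, h, h'⟩ | ⟨Z, h, h'⟩) <;>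
        simp only [BinaryTree.node.injEq, true_and] at h'
      · exact hA (by rw [← h'.1]; exact Rot.numNodes_eq h)
      · exact hA (by rw [h'.1])

/-! ### The left border -/

theorem lastPart_graft (L r : BT) :
    lastPart (graft L (.node () .nil r)) = r.numNodes + 1 := by
  simp [graft, lastPart, composition, pieces, List.getLastD_eq_getLast?]

/-- The edges of the left border of `A / B` below the one that carries `A`. -/
theorem countP_borderCuts_lt (A B : BT) :
    (borderCuts (graft A B)).countP (fun k => decide (k < B.numNodes)) = spine B := by
  induction B with
  | nil => simp [spine]
  | node _ l r ihl _ =>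
    simp only [graft, borderCuts, List.countP_cons, List.countP_map, spine, BinaryTree.numNodes]
    rw [← ihl]
    simp [Function.comp_def, add_assoc]

theorem length_borderCuts (T : BT) : (borderCuts T).length = spine T + 1 := by
  induction T with
  | nil => rfl
  | node _ l r ihl _ => simp [borderCuts, spine, ihl]

variable {L L' r B' : BT}

theorem uDeg_graft (hB : Le (.node () .nil r) B') :
    uDeg (graft L (.node () .nil r)) (graft L' B') = spine B' := by
  have : r.numNodes + 1 = B'.numNodes := by rw [← hB.numNodes_eq]; simp
  rw [uDeg, lastPart_graft, this, countP_borderCuts_lt]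

theorem uDeg_add_vDeg (S T : BT) : uDeg S T + vDeg S T = spine T + 1 := by
  rw [← length_borderCuts,
    List.length_eq_countP_add_countP (fun k => decide (k < lastPart S)), uDeg, vDeg]
  congr 2
  ext k
  simp

theorem vDeg_graft (hB : Le (.node () .nil r) B') :
    vDeg (graft L (.node () .nil r)) (graft L' B') = spine L' + 1 := by
  have h := uDeg_add_vDeg (graft L (.node () .nil r)) (graft L' B')
  rw [uDeg_graft hB, spine_graft] at h
  omega

/-- The rotation at the root of `node R`, where the left subtree is empty, stays below `ins p T`
exactly if the edge number `p` of the left border of `T` belongs to its upper part. -/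
theorem le_ins_iff_uDeg_le {p : ℕ} {T : BT} (hp : p ≤ spine T) (h : Le (.node () L r) T) :
    Le (.node () (.node () .nil L) r) (ins p T) ↔ uDeg (.node () L r) T ≤ p := by
  rw [node_eq_graft] at h
  obtain ⟨T₁, T₂, rfl, h₁, h₂⟩ := h.of_graft
  rw [node_eq_graft L, node_eq_graft (.node () .nil L), uDeg_graft h₂]
  rw [spine_graft] at hp
  constructor
  · intro h'
    obtain ⟨Z₁, Z₂, e, hZ₁, hZ₂⟩ := h'.of_graft
    obtain ⟨T₁', p', rfl, hp', hT₁⟩ := hZ₁.of_node_nil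
    rw [← ins_graft] at e
    obtain ⟨rfl, e'⟩ := ins_inj (by rw [spine_graft]; exact hp)
      (by rw [spine_graft]; omega) e
    obtain ⟨rfl, rfl⟩ := graft_inj (h₁.numNodes_eq.symm.trans hT₁.numNodes_eq) e'
    exact Nat.le_add_left _ _
  · intro hle
    obtain ⟨k, rfl⟩ := Nat.exists_eq_add_of_le' hle
    rw [ins_graft]
    exact Le.graft ((le_ins_iff (by omega)).2 h₁) h₂

/-- The rotations of `node R` stay below `ins p T` like those of `R` below `T`; the additional one
is at the root. -/
theorem upCount_ins {p : ℕ} {R T : BT} (hp : p ≤ spine T) (hR : R ≠ .nil) (h : Le R T) :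
    upCount (.node () .nil R) (ins p T) = upCount R T + if uDeg R T ≤ p then 1 else 0 := by
  cases R with
  | nil => exact absurd rfl hR
  | node _ L r =>
    rw [upCount, ncard_rot_node_nil, upCount]
    simp only [le_ins_iff hp]
    congr 1
    by_cases hu : uDeg (.node () L r) T ≤ p
    · rw [if_pos hu, Set.ncard_eq_one]
      refine ⟨.node () (.node () .nil L) r, ?_⟩
      ext Z
      simp only [BinaryTree.node.injEq, true_and, Set.mem_ofPred_eq, Set.mem_singleton_iff]
      constructor
      · rintro ⟨⟨_, _, ⟨rfl, rfl⟩, rfl⟩, -⟩; rfl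
      · rintro rfl
        exact ⟨⟨L, r, ⟨rfl, rfl⟩, rfl⟩, (le_ins_iff_uDeg_le hp h).2 hu⟩
    · rw [if_neg hu, Set.ncard_eq_zero ((finite_rot_and (.node () .nil (.node () L r))
        (fun Z => Le Z (ins p T))).subset ?_), Set.eq_empty_iff_forall_notMem]
      · rintro Z ⟨⟨_, _, e, rfl⟩, hle⟩
        cases e
        exact hu ((le_ins_iff_uDeg_le hp h).1 hle)
      · rintro Z ⟨⟨_, _, e, rfl⟩, hle⟩
        cases e
        exact ⟨.root _ _ _, hle⟩

/-! ### The statistics of the Tamari lattices, on trees -/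

section Translation

variable {n : ℕ}

theorem ncard_tam (S : Tam n) (p : BT → Prop) (hp : ∀ T, p T → T.numNodes = S.1.numNodes) :
    {T : Tam n | p T.1}.ncard = {T | p T}.ncard := by
  have e : {T | p T} = Subtype.val '' {T : Tam n | p T.1} := by
    ext T
    constructor
    · exact fun h => ⟨⟨T, (hp T h).trans S.2⟩, h, rfl⟩
    · rintro ⟨T, h, rfl⟩
      exact h
  rw [e]
  exact (Set.ncard_image_of_injective _ Subtype.val_injective).symm

theorem xDeg_eq_upCount (S T : Tam n) : xDeg S T = upCount S.1 T.1 := by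
  simp only [xDeg, covBy_iff_rot]
  exact ncard_tam S (fun Z => Rot S.1 Z ∧ Le Z T.1) fun _ h => h.1.numNodes_eq.symm

theorem yDeg_eq_rotCount (T : Tam n) : yDeg T = rotCount T.1 := by
  simp only [yDeg, covBy_iff_rot]
  exact ncard_tam T (fun Z => Rot T.1 Z) fun _ h => h.numNodes_eq.symm

theorem ybarDeg_eq_downCount (S : Tam n) : ybarDeg S = downCount S.1 := by
  simp only [ybarDeg, covBy_iff_rot]
  exact ncard_tam S (fun Z => Rot Z S.1) fun _ h => h.numNodes_eq

theorem RotChain.exists_ltSeries {m : ℕ} {S T : BT} (h : RotChain m S T) (hS : S.numNodes = n)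
    (hT : T.numNodes = n) : ∃ c : LTSeries (Tam n),
      c.head = ⟨S, hS⟩ ∧ c.last = ⟨T, hT⟩ ∧ c.length = m := by
  induction h with
  | refl S => exact ⟨RelSeries.singleton _ ⟨S, hS⟩, rfl, rfl, rfl⟩
  | @tail m S T T' h r ih =>
    obtain ⟨c, hc, hc', rfl⟩ := ih hS (r.numNodes_eq.trans hT)
    have hlt : c.last < ⟨T', hT⟩ := by
      rw [hc']
      exact (covBy_iff_rot.2 r).lt
    exact ⟨c.snoc _ hlt, (RelSeries.head_snoc c _ hlt).trans hc, RelSeries.last_snoc c _ hlt,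
      RelSeries.snoc_length c _ hlt⟩

/-- The steps of a strict chain need not be covers, but refining each of them to rotations only
makes the chain longer. -/
theorem exists_rotChain_of_ltSeries (c : LTSeries (Tam n)) :
    ∃ m, c.length ≤ m ∧ RotChain m c.head.1 c.last.1 := by
  suffices h : ∀ i : Fin (c.length + 1), ∃ m, (i : ℕ) ≤ m ∧ RotChain m (c 0).1 (c i).1 from
    h (Fin.last _)
  intro i
  induction i using Fin.induction with
  | zero => exact ⟨0, le_rfl, .refl _⟩
  | succ i ih =>
    obtain ⟨m, hm, h⟩ := ih
    have hlt : c i.castSucc < c i.succ := c.step i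
    obtain ⟨k, hk⟩ := Le.exists_rotChain hlt.le
    have : k ≠ 0 := by
      rintro rfl
      generalize hA : (c i.castSucc).1 = A at hk
      generalize hB : (c i.succ).1 = B at hk
      cases hk
      exact hlt.ne (Subtype.ext (hA.trans hB.symm))
    exact ⟨m + k, by simp at hm ⊢; omega, h.trans hk⟩

theorem longestChain_eq_maxChain {S T : Tam n} (h : S ≤ T) :
    longestChain S T = maxChain S.1 T.1 := by
  refine IsGreatest.csSup_eq ⟨?_, ?_⟩
  · exact (Le.rotChain_maxChain h).exists_ltSeries S.2 T.2
  · rintro _ ⟨c, rfl, rfl, rfl⟩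
    obtain ⟨m, hm, h⟩ := exists_rotChain_of_ltSeries c
    exact hm.trans h.le_maxChain

end Translation

/-! ### The monomial of an interval -/

/-- The monomial of the interval `(S, T)`, with `u = a`, `v = b` and `c` marking the length of the
longest chain; the values `c = 1` and `c = q` give the two versions of the series. -/
noncomputable def intervalMonomial (a b c : K) (S T : BT) : K :=
  a ^ uDeg S T * b ^ vDeg S T * var .x ^ upCount S T * var .y ^ rotCount T *
    var .ybar ^ downCount S * c ^ maxChain S T

theorem substUV_weight (a b : K) {n : ℕ} (S T : Tam n) :
    substUV a b (weight S T) = intervalMonomial a b 1 S.1 T.1 := by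
  simp [weight, intervalMonomial, substUV, xDeg_eq_upCount, yDeg_eq_rotCount,
    ybarDeg_eq_downCount]

theorem substUV_weightQ (a b : K) {n : ℕ} {S T : Tam n} (h : S ≤ T) :
    substUV a b (weightQ S T) = intervalMonomial a b (var .q) S.1 T.1 := by
  rw [weightQ, map_mul, substUV_weight, longestChain_eq_maxChain h]
  simp [intervalMonomial, substUV]

theorem Indecomposable.exists_eq {S : BT} (h : Indecomposable S) : ∃ r, S = .node () .nil r :=
  (indecomposable_iff S).1 h

/-- All statistics add under grafting, except that the border edge shared by the two factors is
counted once, whence `1 / v`, and that grafting creates one vertex with an inner left child,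
whence `ȳ`. In the first factor the whole left border belongs to the upper part, whence the
argument `(v, v)`. -/
theorem intervalMonomial_graft (u c : K) {v : K} (hv : v ≠ 0) {A A' B B' : BT} (hA₀ : A ≠ .nil)
    (hB₀ : Indecomposable B) (hA : Le A A') (hB : Le B B') :
    intervalMonomial u v c (graft A B) (graft A' B') =
      var .ybar / v * (intervalMonomial v v c A A' * intervalMonomial u v c B B') := by
  obtain ⟨r, rfl⟩ := hB₀.exists_eq
  have hu : uDeg (.node () .nil r) B' = spine B' := uDeg_graft (L := .nil) (L' := .nil) hB ▸ by
    rw [graft_nil_left, graft_nil_left]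
  have hv₁ := uDeg_add_vDeg (.node () .nil r) B'
  have hv' : vDeg (.node () .nil r) B' = 1 := by omega
  have hs : v ^ uDeg A A' * v ^ vDeg A A' = v ^ (spine A' + 1) := by
    rw [← pow_add, uDeg_add_vDeg]
  simp only [intervalMonomial]
  rw [uDeg_graft hB, vDeg_graft hB, upCount_graft hA hB, rotCount_graft, downCount_graft hA₀,
    maxChain_graft hA hB, hs, hu, hv']
  field_simp
  ring

/-- The sum of the monomials of the intervals obtained from `(R, T)` by inserting a new first
vertex, on all edges of the left border of `T`. The edges of the lower part, those of the upper
part and the top edge give the three terms. -/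
theorem sum_intervalMonomial_ins {u c : K} (v : K) (hc : c ≠ 0) (hcu : c * u - 1 ≠ 0) {R T : BT}
    (hR : R ≠ .nil) (h : Le R T) :
    ∑ p ∈ Finset.range (spine T + 1), intervalMonomial u v c (.node () .nil R) (ins p T) =
      v * (var .y * u / (c * u - 1) *
            (intervalMonomial (c * u) 1 c R T - intervalMonomial 1 1 c R T) +
          var .x * var .y * u / (c * u - 1) *
            (intervalMonomial (c * u) (c * u) c R T - intervalMonomial (c * u) 1 c R T) +
          (var .x - var .x * var .y) / c * intervalMonomial (c * u) (c * u) c R T) := by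
  obtain ⟨i, hi⟩ : ∃ i, uDeg R T = i := ⟨_, rfl⟩
  obtain ⟨j, hj⟩ : ∃ j, vDeg R T = j + 1 := by
    cases R with
    | nil => exact absurd rfl hR
    | node _ L r =>
      rw [node_eq_graft] at h ⊢
      obtain ⟨T₁, T₂, rfl, -, h₂⟩ := h.of_graft
      exact ⟨_, vDeg_graft h₂⟩
  have hs : spine T = i + j := by have := uDeg_add_vDeg R T; omega
  set m : K := var .x ^ upCount R T * var .y ^ rotCount T * var .ybar ^ downCount R *
    c ^ maxChain R T with hm
  have hmono : ∀ a b : K, intervalMonomial a b c R T = a ^ i * b ^ (j + 1) * m := by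
    intro a b
    rw [intervalMonomial, hi, hj, hm]
    ring
  -- The upper part consists of the edges `i, …, i + j`, the last of which is the top edge.
  have hins : ∀ p ≤ i + j, intervalMonomial u v c (.node () .nil R) (ins p T) =
      v * m * u * (c * u) ^ p * (if i ≤ p then var .x else 1) *
        (if p < i + j then var .y else 1) := by
    intro p hp
    rw [← hs] at hp
    have hle := (le_ins_iff hp).2 h
    have hu : uDeg (.node () .nil R) (ins p T) = p + 1 := by
      have := uDeg_graft (L := .nil) (L' := .nil) hle
      rwa [graft_nil_left, graft_nil_left, spine_ins hp] at this
    have hv := uDeg_add_vDeg (.node () .nil R) (ins p T)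
    have hv' : vDeg (.node () .nil R) (ins p T) = 1 := by
      rw [spine_ins hp] at hv
      omega
    rw [intervalMonomial, hu, hv', upCount_ins hp hR h, rotCount_ins hp, downCount_node_nil,
      maxChain_ins hp h, hi, hs, hm]
    split_ifs <;> ring
  -- The lower part of the border contributes a geometric sum of ratio `c * u` ...
  have hlow : ∑ p ∈ Finset.range i, intervalMonomial u v c (.node () .nil R) (ins p T) =
      v * m * u * var .y * (((c * u) ^ i - 1) / (c * u - 1)) := by
    rw [← geom_sum_eq (sub_ne_zero.1 hcu), Finset.mul_sum]
    refine Finset.sum_congr rfl fun p hp => ?_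
    have hp := Finset.mem_range.1 hp
    rw [hins p (by omega), if_neg (by omega), if_pos (by omega)]
    ring
  -- ... and so do the edges of the upper part other than the top one.
  have hmid : ∑ p ∈ Finset.range j, intervalMonomial u v c (.node () .nil R) (ins (i + p) T) =
      v * m * u * var .x * var .y * (c * u) ^ i * (((c * u) ^ j - 1) / (c * u - 1)) := by
    rw [← geom_sum_eq (sub_ne_zero.1 hcu), Finset.mul_sum]
    refine Finset.sum_congr rfl fun p hp => ?_
    have hp := Finset.mem_range.1 hp
    rw [hins _ (by omega), if_pos (by omega), if_pos (by omega)]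
    ring
  rw [hs, Finset.sum_range_succ, Finset.sum_range_add, hlow, hmid, hins _ le_rfl,
    if_pos (by omega), if_neg (by omega), hmono, hmono, hmono, pow_succ (c * u) j]
  have hdiv : (var .x - var .x * var .y) / c * ((c * u) ^ i * ((c * u) ^ j * (c * u)) * m) =
      (var .x - var .x * var .y) * u * (c * u) ^ i * (c * u) ^ j * m := by
    field_simp
  rw [hdiv, pow_add]
  simp only [div_eq_mul_inv, one_pow, mul_one, one_mul]
  linear_combination -(v * m * u * var .x * var .y * (c * u) ^ i * (c * u) ^ j) *
    mul_inv_cancel₀ hcu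

/-! ### Sums over intervals -/

open Classical in
/-- The intervals of trees with `n` inner vertices; the interval of the leaf is left out. -/
noncomputable def intervals (n : ℕ) : Finset (BT × BT) :=
  (BinaryTree.treesOfNumNodesEq n ×ˢ BinaryTree.treesOfNumNodesEq n).filter
    fun I => Le I.1 I.2 ∧ I.1 ≠ .nil

open Classical in
/-- The indecomposable intervals of trees with `n` inner vertices. -/
noncomputable def indecIntervals (n : ℕ) : Finset (BT × BT) :=
  (intervals n).filter fun I => Indecomposable I.1

theorem mem_intervals {n : ℕ} {I : BT × BT} :
    I ∈ intervals n ↔ I.1.numNodes = n ∧ Le I.1 I.2 ∧ I.1 ≠ .nil := by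
  simp only [intervals, Finset.mem_filter, Finset.mem_product,
    BinaryTree.mem_treesOfNumNodesEq]
  exact ⟨fun h => ⟨h.1.1, h.2⟩, fun h => ⟨⟨h.1, h.2.1.numNodes_eq.symm.trans h.1⟩, h.2⟩⟩

theorem mem_indecIntervals {n : ℕ} {I : BT × BT} :
    I ∈ indecIntervals n ↔ I.1.numNodes = n ∧ Le I.1 I.2 ∧ Indecomposable I.1 := by
  simp only [indecIntervals, Finset.mem_filter, mem_intervals]
  exact ⟨fun h => ⟨h.1.1, h.1.2.1, h.2⟩, fun h => ⟨⟨h.1, h.2.1, h.2.2.1⟩, h.2.2⟩⟩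

/-- The generating series of all intervals, at `u = a`, `v = b`. -/
noncomputable def intervalSeries (a b c : K) : K⟦X⟧ :=
  PowerSeries.mk fun n => ∑ I ∈ intervals n, intervalMonomial a b c I.1 I.2

/-- The generating series of the indecomposable intervals, at `u = a`, `v = b`. -/
noncomputable def indecIntervalSeries (a b c : K) : K⟦X⟧ :=
  PowerSeries.mk fun n => ∑ I ∈ indecIntervals n, intervalMonomial a b c I.1 I.2

/-! ### The functional equations -/

open Classical in
/-- On every interval the weight `w` becomes the monomial, so the coefficients agree; the interval of
the leaf is excluded on both sides. -/
theorem map_allSeries {a b c : K} {w : ∀ {n : ℕ}, Tam n → Tam n → Coeff}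
    (hw : ∀ {n : ℕ} {S T : Tam n}, S ≤ T →
      substUV a b (w S T) = intervalMonomial a b c S.1 T.1) :
    PowerSeries.map (substUV a b : Coeff →+* K) (allSeries w) = intervalSeries a b c := by
  ext n
  simp only [PowerSeries.coeff_map, allSeries, intervalSeries, PowerSeries.coeff_mk]
  split_ifs with hn
  · subst hn
    rw [map_zero, Finset.sum_eq_zero]
    intro I hI
    obtain ⟨h0, -, hne⟩ := mem_intervals.1 hI
    cases h : I.1 with
    | nil => exact absurd h hne
    | node => rw [h] at h0; simp at h0
  · rw [map_sum]
    refine Finset.sum_nbij (fun I => (I.1.1, I.2.1)) ?_ ?_ ?_ ?_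
    · intro I hI
      refine mem_intervals.2 ⟨I.1.2, (Finset.mem_filter.1 hI).2, fun h => hn ?_⟩
      exact I.1.2.symm.trans (congrArg BinaryTree.numNodes h)
    · intro I _ J _ h
      simp only [Prod.mk.injEq] at h
      exact Prod.ext (Subtype.ext h.1) (Subtype.ext h.2)
    · rintro ⟨S, T⟩ hI
      obtain ⟨hS, hle, -⟩ := mem_intervals.1 hI
      exact ⟨(⟨S, hS⟩, ⟨T, hle.numNodes_eq.symm.trans hS⟩),
        Finset.mem_coe.2 (Finset.mem_filter.2 ⟨Finset.mem_univ _, hle⟩), rfl⟩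
    · exact fun I hI => hw (Finset.mem_filter.1 hI).2

open Classical in
theorem map_indecSeries {a b c : K} {w : ∀ {n : ℕ}, Tam n → Tam n → Coeff}
    (hw : ∀ {n : ℕ} {S T : Tam n}, S ≤ T →
      substUV a b (w S T) = intervalMonomial a b c S.1 T.1) :
    PowerSeries.map (substUV a b : Coeff →+* K) (indecSeries w) = indecIntervalSeries a b c := by
  ext n
  simp only [PowerSeries.coeff_map, indecSeries, indecIntervalSeries, PowerSeries.coeff_mk]
  split_ifs with hn
  · subst hn
    rw [map_zero, Finset.sum_eq_zero]
    intro I hI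
    obtain ⟨h0, -, hI⟩ := mem_indecIntervals.1 hI
    obtain ⟨r, hr⟩ := hI.exists_eq
    rw [hr] at h0
    simp at h0
  · rw [map_sum]
    refine Finset.sum_nbij (fun I => (I.1.1, I.2.1)) ?_ ?_ ?_ ?_
    · exact fun I hI => mem_indecIntervals.2 ⟨I.1.2, (Finset.mem_filter.1 hI).2⟩
    · intro I _ J _ h
      simp only [Prod.mk.injEq] at h
      exact Prod.ext (Subtype.ext h.1) (Subtype.ext h.2)
    · rintro ⟨S, T⟩ hI
      obtain ⟨hS, hle, hi⟩ := mem_indecIntervals.1 hI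
      exact ⟨(⟨S, hS⟩, ⟨T, hle.numNodes_eq.symm.trans hS⟩),
        Finset.mem_coe.2 (Finset.mem_filter.2 ⟨Finset.mem_univ _, hle, hi⟩), rfl⟩
    · exact fun I hI => hw (Finset.mem_filter.1 hI).2.1

theorem numNodes_pos {S : BT} (h : S ≠ .nil) : 0 < S.numNodes := by
  cases S with
  | nil => exact absurd rfl h
  | node => simp

open Classical in
/-- A decomposable interval is a grafting `(A / B, A' / B')` of an interval `(A, A')` and an
indecomposable interval `(B, B')`, in a unique way. -/
theorem intervalSeries_eq (u c : K) {v : K} (hv : v ≠ 0) :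
    intervalSeries u v c = indecIntervalSeries u v c +
      (var .ybar / v) • (intervalSeries v v c * indecIntervalSeries u v c) := by
  ext n
  rw [map_add, map_smul, PowerSeries.coeff_mul]
  simp only [intervalSeries, indecIntervalSeries, PowerSeries.coeff_mk]
  rw [← Finset.sum_filter_add_sum_filter_not (intervals n) fun I => Indecomposable I.1]
  congr 1
  symm
  rw [Finset.smul_sum, Finset.sum_congr rfl fun x _ => by
    rw [Finset.sum_mul_sum, ← Finset.sum_product', Finset.smul_sum], Finset.sum_sigma']
  refine Finset.sum_nbij
    (fun x => (graft x.2.1.1 x.2.2.1, graft x.2.1.2 x.2.2.2)) ?_ ?_ ?_ ?_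
  · rintro ⟨⟨i, j⟩, ⟨A, A'⟩, B, B'⟩ hx
    simp only [Finset.mem_sigma, Finset.mem_product, mem_intervals,
      mem_indecIntervals] at hx
    obtain ⟨hij, ⟨rfl, hA, hA₀⟩, rfl, hB, hB₀⟩ := hx
    obtain ⟨r, rfl⟩ := hB₀.exists_eq
    rw [Finset.mem_filter, mem_intervals]
    refine ⟨⟨(numNodes_graft _ _).trans (Finset.HasAntidiagonal.mem_antidiagonal.1 hij),
      hA.graft hB, by simp [graft]⟩, fun h => ?_⟩
    rcases h.2 A _ rfl with h | h
    · exact hA₀ h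
    · simp at h
  · rintro ⟨⟨i, j⟩, ⟨A, A'⟩, B, B'⟩ hx ⟨⟨k, l⟩, ⟨C, C'⟩, D, D'⟩ hy h
    simp only [Finset.mem_coe, Finset.mem_sigma, Finset.mem_product,
      mem_intervals, mem_indecIntervals] at hx hy
    obtain ⟨-, ⟨rfl, hA, -⟩, rfl, -, hB₀⟩ := hx
    obtain ⟨-, ⟨rfl, hC, -⟩, rfl, -, hD₀⟩ := hy
    obtain ⟨r, rfl⟩ := hB₀.exists_eq
    obtain ⟨s, rfl⟩ := hD₀.exists_eq
    simp only [Prod.mk.injEq] at h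
    obtain ⟨h, h'⟩ := h
    simp only [graft, BinaryTree.node.injEq, true_and] at h
    obtain ⟨rfl, rfl⟩ := h
    obtain ⟨rfl, rfl⟩ := graft_inj (hA.numNodes_eq.symm.trans hC.numNodes_eq) h'
    rfl
  · rintro ⟨S, T⟩ hI
    rw [Finset.mem_coe, Finset.mem_filter, mem_intervals] at hI
    obtain ⟨⟨hS, hle, hne⟩, hdec⟩ := hI
    cases S with
    | nil => exact absurd rfl hne
    | node _ L r =>
      rw [node_eq_graft] at hle
      obtain ⟨T₁, T₂, rfl, h₁, h₂⟩ := hle.of_graft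
      refine ⟨⟨(L.numNodes, r.numNodes + 1), (L, T₁), (.node () .nil r, T₂)⟩, ?_, rfl⟩
      simp only [Finset.mem_coe, Finset.mem_sigma, Finset.mem_product,
        mem_intervals, mem_indecIntervals]
      refine ⟨Finset.HasAntidiagonal.mem_antidiagonal.2 ?_, ⟨trivial, h₁, ?_⟩, by simp, h₂,
        (indecomposable_iff _).2 ⟨r, rfl⟩⟩
      · simp only [BinaryTree.numNodes] at hS
        omega
      · rintro rfl
        exact hdec ((indecomposable_iff _).2 ⟨r, rfl⟩)
  · rintro ⟨⟨i, j⟩, ⟨A, A'⟩, B, B'⟩ hx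
    simp only [Finset.mem_sigma, Finset.mem_product, mem_intervals,
      mem_indecIntervals] at hx
    obtain ⟨-, ⟨-, hA, hA₀⟩, -, hB, hB₀⟩ := hx
    exact (intervalMonomial_graft u c hv hA₀ hB₀ hA hB).symm

/-- The single vertex is the insertion into `R = nil`. It is treated apart because `upCount_ins`
fails there: no rotation at the root exists. -/
theorem sum_indecIntervals_one (u v c : K) :
    ∑ I ∈ indecIntervals 1, intervalMonomial u v c I.1 I.2 = v * u := by
  have hle : Le (.node () .nil .nil) (.node () .nil .nil) := .refl
  have e : indecIntervals 1 = {(.node () .nil .nil, .node () .nil .nil)} := by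
    ext ⟨S, T⟩
    rw [mem_indecIntervals, Finset.mem_singleton, Prod.mk.injEq]
    constructor
    · rintro ⟨hS, hST, hi⟩
      obtain ⟨r, rfl⟩ := hi.exists_eq
      cases r with
      | node => simp at hS
      | nil =>
        obtain ⟨T', p, rfl, hp, h⟩ := hST.of_node_nil
        have := h.numNodes_eq
        cases T' with
        | node => simp at this
        | nil =>
          obtain rfl : p = 0 := Nat.le_zero.1 hp
          exact ⟨rfl, rfl⟩
    · rintro ⟨rfl, rfl⟩
      exact ⟨by simp, hle, (indecomposable_iff _).2 ⟨_, rfl⟩⟩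
  have hup : upCount (.node () .nil .nil) (.node () .nil .nil) = 0 := by
    have : {Z | Rot (.node () .nil .nil) Z ∧ Le Z (.node () .nil .nil)} = ∅ :=
      Set.eq_empty_iff_forall_notMem.2 fun Z h => h.1.not_le h.2
    rw [upCount, this, Set.ncard_empty]
  have hdown : downCount .nil = 0 := by
    have : {S | Rot S .nil} = ∅ := Set.eq_empty_iff_forall_notMem.2 fun Z h => by
      cases (h : Rot Z .nil)
    rw [downCount, this, Set.ncard_empty]
  have hrot : rotCount (.node () .nil .nil) = 0 := by
    simpa [ins, spine, rotCount_nil] using rotCount_ins (p := 0) (T := .nil) le_rfl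
  have hmax : maxChain (.node () .nil .nil) (.node () .nil .nil) = 0 := by
    have := (Le.rotChain_maxChain hle).potential_add_le
    omega
  rw [e, Finset.sum_singleton, intervalMonomial, hup, hrot, downCount_node_nil, hdown, hmax]
  simp [uDeg, vDeg, borderCuts, lastPart, composition, pieces, mul_comm]

/-- An indecomposable interval is obtained by inserting a new first vertex in an interval `(R, T)`,
as the root in `R` and on any edge of the left border of `T`, in a unique way. -/
theorem sum_indecIntervals_succ {n : ℕ} (hn : n ≠ 0) (f : BT → BT → K) :
    ∑ I ∈ indecIntervals (n + 1), f I.1 I.2 =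
      ∑ I ∈ intervals n, ∑ p ∈ Finset.range (spine I.2 + 1),
        f (.node () .nil I.1) (ins p I.2) := by
  rw [Finset.sum_sigma']
  symm
  refine Finset.sum_nbij (fun x => (.node () .nil x.1.1, ins x.2 x.1.2)) ?_ ?_ ?_ ?_
  · rintro ⟨⟨R, T⟩, p⟩ hx
    simp only [Finset.mem_sigma, mem_intervals, Finset.mem_range, Nat.lt_succ_iff] at hx
    obtain ⟨⟨rfl, hle, -⟩, hp⟩ := hx
    exact mem_indecIntervals.2
      ⟨by simp, (le_ins_iff hp).2 hle, (indecomposable_iff _).2 ⟨_, rfl⟩⟩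
  · rintro ⟨⟨R, T⟩, p⟩ hx ⟨⟨R', T'⟩, p'⟩ hy h
    simp only [Finset.mem_coe, Finset.mem_sigma, mem_intervals, Finset.mem_range,
      Nat.lt_succ_iff] at hx hy
    simp only [Prod.mk.injEq, BinaryTree.node.injEq, true_and] at h
    obtain ⟨rfl, h⟩ := h
    obtain ⟨rfl, rfl⟩ := ins_inj hx.2 hy.2 h
    rfl
  · rintro ⟨S, T⟩ hI
    obtain ⟨hS, hle, hi⟩ := mem_indecIntervals.1 hI
    obtain ⟨R, rfl⟩ := hi.exists_eq
    obtain ⟨T', p, rfl, hp, h⟩ := Le.of_node_nil hle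
    refine ⟨⟨(R, T'), p⟩, ?_, rfl⟩
    simp only [Finset.mem_coe, Finset.mem_sigma, mem_intervals, Finset.mem_range,
      Nat.lt_succ_iff]
    have hR : R.numNodes = n := by simpa using hS
    refine ⟨⟨hR, h, ?_⟩, hp⟩
    rintro rfl
    exact hn hR.symm
  · exact fun _ _ => rfl

/-- Summing over the positions of the inserted vertex gives the divided differences. The hypotheses
on `c` and `c * u - 1` make the divisions genuine. -/
theorem indecIntervalSeries_eq {u c : K} (v : K) (hc : c ≠ 0) (hcu : c * u - 1 ≠ 0) :
    indecIntervalSeries u v c = v • (PowerSeries.X * (PowerSeries.C u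
      + (var .y * u / (c * u - 1)) • (intervalSeries (c * u) 1 c - intervalSeries 1 1 c)
      + (var .x * var .y * u / (c * u - 1)) •
          (intervalSeries (c * u) (c * u) c - intervalSeries (c * u) 1 c)
      + ((var .x - var .x * var .y) / c) • intervalSeries (c * u) (c * u) c)) := by
  have h0 : intervals 0 = ∅ := by
    refine Finset.eq_empty_of_forall_notMem fun I hI => ?_
    obtain ⟨h, -, hne⟩ := mem_intervals.1 hI
    exact (numNodes_pos hne).ne' h
  ext n
  rw [map_smul]
  cases n with
  | zero =>
    have h0' : indecIntervals 0 = ∅ := by rw [indecIntervals, h0]; rfl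
    simp [indecIntervalSeries, h0']
  | succ n =>
    rw [PowerSeries.coeff_succ_X_mul]
    simp only [map_add, map_sub, map_smul, intervalSeries, indecIntervalSeries,
      PowerSeries.coeff_mk, PowerSeries.coeff_C, smul_eq_mul]
    split_ifs with hn
    · subst hn
      rw [sum_indecIntervals_one, h0]
      simp
    · rw [sum_indecIntervals_succ hn]
      simp only [zero_add, ← Finset.sum_sub_distrib, Finset.mul_sum, ← Finset.sum_add_distrib]
      refine Finset.sum_congr rfl fun I hI => ?_
      obtain ⟨-, hle, hne⟩ := mem_intervals.1 hI
      exact sum_intervalMonomial_ins v hc hcu hne hle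

theorem var_ne_zero (i : Var) : var i ≠ 0 := by
  rw [var, Ne, FaithfulSMul.algebraMap_eq_zero_iff]
  exact MvPolynomial.X_ne_zero i

theorem algebraMap_sub_one_ne_zero {P : Coeff} (hP : MvPolynomial.constantCoeff P = 0) :
    algebraMap Coeff K P - 1 ≠ 0 := by
  rw [← map_one (algebraMap Coeff K), ← map_sub, Ne, FaithfulSMul.algebraMap_eq_zero_iff]
  intro h
  have := congrArg MvPolynomial.constantCoeff h
  simp [hP] at this

theorem Phi_eq (a b : K) : Phi a b = intervalSeries a b 1 :=
  map_allSeries fun {_ S T} _ => substUV_weight a b S T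

theorem Theta_eq (a b : K) : Theta a b = indecIntervalSeries a b 1 :=
  map_indecSeries fun {_ S T} _ => substUV_weight a b S T

theorem PhiQ_eq (a b : K) : PhiQ a b = intervalSeries a b (var .q) :=
  map_allSeries fun h => substUV_weightQ a b h

theorem ThetaQ_eq (a b : K) : ThetaQ a b = indecIntervalSeries a b (var .q) :=
  map_indecSeries fun h => substUV_weightQ a b h

end Tamari

theorem mainTheorem3
    (t : PowerSeries Tamari.K) (ht : t = PowerSeries.X)
    (u v x y ybar q : Tamari.K)
    (hu : u = Tamari.var .u) (hv : v = Tamari.var .v) (hx : x = Tamari.var .x)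
    (hy : y = Tamari.var .y) (hybar : ybar = Tamari.var .ybar) (hq : q = Tamari.var .q) :
    (Tamari.Phi u v =
        Tamari.Theta u v + (ybar / v) • (Tamari.Phi v v * Tamari.Theta u v)) ∧
    (Tamari.Theta u v =
        v • (t * (PowerSeries.C u
          + (y * u / (u - 1)) • (Tamari.Phi u 1 - Tamari.Phi 1 1)
          + (x * y * u / (u - 1)) • (Tamari.Phi u u - Tamari.Phi u 1)
          + (x - x * y) • Tamari.Phi u u))) ∧
    (Tamari.PhiQ u v =
        Tamari.ThetaQ u v + (ybar / v) • (Tamari.PhiQ v v * Tamari.ThetaQ u v)) ∧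
    (Tamari.ThetaQ u v =
        v • (t * (PowerSeries.C u
          + (y * u / (q * u - 1)) • (Tamari.PhiQ (q * u) 1 - Tamari.PhiQ 1 1)
          + (x * y * u / (q * u - 1)) • (Tamari.PhiQ (q * u) (q * u) - Tamari.PhiQ (q * u) 1)
          + ((x - x * y) / q) • Tamari.PhiQ (q * u) (q * u)))) := by
  subst ht hu hv hx hy hybar hq
  simp only [Tamari.Phi_eq, Tamari.Theta_eq, Tamari.PhiQ_eq, Tamari.ThetaQ_eq]
  refine ⟨Tamari.intervalSeries_eq _ _ (Tamari.var_ne_zero _), ?_,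
    Tamari.intervalSeries_eq _ _ (Tamari.var_ne_zero _), ?_⟩
  · have h := Tamari.indecIntervalSeries_eq (u := Tamari.var .u) (c := 1) (Tamari.var .v)
      one_ne_zero (by rw [one_mul]; exact Tamari.algebraMap_sub_one_ne_zero (by simp))
    simpa only [one_mul, div_one] using h
  · refine Tamari.indecIntervalSeries_eq _ (Tamari.var_ne_zero _) ?_
    rw [Tamari.var, Tamari.var, ← map_mul]
    exact Tamari.algebraMap_sub_one_ne_zero (by simp)
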